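/- All matroids are finite. Two distinct elements $e,f$ of a matroid $M$ are clones if the permutation of $E(M)$ that swaps $e$ and $f$ and fixes all other elements is an automorphism of $M$. A matroid is clone reducible if each of its minors with at least two elements has a pair of clones. For an oriented matroid $O$ on $E$, a flow (respectively, coflow) of $O$ is an element of the integer lattice in $\mathbb{Z}^E$ generated by the signed characteristic vectors of the signed circuits (respectively, signed cocircuits) of $O$. The oriented matroid $O$ is GSP (generalized series parallel) if every simple minor of $O$ with nonempty ground set has a nonzero coflow with all entries in $\{0,1,-1\}$ and at most two nonzero entries; it is coGSP if every cosimple minor of $O$ with nonempty ground set has a nonzero flow with all entries in $\{0,1,-1\}$ and at most two nonzero entries. **Observation.** If $M$ is a clone reducible matroid, then every orientation of $M$ (every oriented matroid whose underlying matroid is $M$) is both GSP and coGSP. -/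

import Mathlib

namespace Matroid

variable {α : Type*}

/-! ### Simple and cosimple matroids, clones -/

/-- A matroid is simple if it has no loops and no parallel pairs, that is, no circuit with at most
two elements. -/
def IsSimple (M : Matroid α) : Prop :=
  ∀ C, M.IsCircuit C → 2 < C.encard

/-- A matroid is cosimple if its dual is simple. -/
def IsCosimple (M : Matroid α) : Prop :=
  M✶.IsSimple

open Classical in
/-- Two distinct elements `e`, `f` of `M` are clones if the transposition of `e` and `f` is an
automorphism of `M`. -/
def AreClones (M : Matroid α) (e f : α) : Prop :=
  e ∈ M.E ∧ f ∈ M.E ∧ e ≠ f ∧ M.mapEquiv (Equiv.swap e f) = M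

/-- `M` is clone reducible if every minor with at least two elements has a pair of clones. -/
def CloneReducible (M : Matroid α) : Prop :=
  ∀ N : Matroid α, N.IsMinor M → 2 ≤ N.E.encard → ∃ e f, N.AreClones e f

/-! ### Signed circuits and orientations

A signed set `X = (X⁺, X⁻)` is encoded by its signed vector `X : α → SignType`, so that
`X⁺ = {e | X e = 1}`, `X⁻ = {e | X e = -1}`, and the underlying set is `Function.support X`. -/

/-- A family of signed sets, closed under negation, whose underlying sets are exactly the
circuits of `M`. -/
structure SignedCircuits (M : Matroid α) where
  circuits : Set (α → SignType)
  neg_mem : ∀ X ∈ circuits, -X ∈ circuits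
  isCircuit_iff : ∀ C : Set α, M.IsCircuit C ↔ ∃ X ∈ circuits, Function.support X = C

/-- An orientation of `M`: an oriented matroid, given by its signed circuits (with the signed
circuit axioms), whose underlying matroid is `M`. Signed circuits are nonempty because circuits
of a matroid are. -/
structure Orientation (M : Matroid α) extends SignedCircuits M where
  eq_or_eq_neg : ∀ X ∈ circuits, ∀ Y ∈ circuits,
    Function.support X ⊆ Function.support Y → X = Y ∨ X = -Y
  elimination : ∀ X ∈ circuits, ∀ Y ∈ circuits, X ≠ -Y → ∀ e, X e = 1 → Y e = -1 →
    ∃ Z ∈ circuits, Z e = 0 ∧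
      (∀ g, Z g = 1 → X g = 1 ∨ Y g = 1) ∧ (∀ g, Z g = -1 → X g = -1 ∨ Y g = -1)

/-- Orthogonality of signed sets: either their underlying sets are disjoint, or there are
an element of the intersection where the signs agree and one where they are opposite. -/
def SignOrthogonal (X Y : α → SignType) : Prop :=
  (∀ e, X e * Y e = 0) ∨ ((∃ e, X e * Y e = 1) ∧ ∃ f, X f * Y f = -1)

namespace SignedCircuits

variable {M : Matroid α}

/-- Signed cocircuits: signed sets supported on cocircuits of the underlying matroid and
orthogonal to every signed circuit. For an oriented matroid these are the signed circuits of
the dual oriented matroid. -/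
def cocircuits (O : SignedCircuits M) : Set (α → SignType) :=
  {Y | M.IsCocircuit (Function.support Y) ∧ ∀ X ∈ O.circuits, SignOrthogonal X Y}

/-- The flow lattice: the integer lattice generated by the signed vectors of the circuits. -/
def flowLattice (O : SignedCircuits M) : AddSubgroup (α → ℤ) :=
  AddSubgroup.closure ((fun X e => (X e : ℤ)) '' O.circuits)

/-- The coflow lattice: the integer lattice generated by the signed vectors of the cocircuits. -/
def coflowLattice (O : SignedCircuits M) : AddSubgroup (α → ℤ) :=
  AddSubgroup.closure ((fun Y e => (Y e : ℤ)) '' O.cocircuits)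

/-- The minor obtained by contracting `A` and deleting `B`. The signed circuits of the contraction
are the restrictions `X \ A` of signed circuits `X` whose underlying set is nonempty and minimal,
that is, a circuit of the contracted matroid; those of the deletion are the ones that avoid `B`. -/
def minor (O : SignedCircuits M) (A B : Set α) : SignedCircuits ((M.contract A).delete B) where
  circuits := {Y | ((M.contract A).delete B).IsCircuit (Function.support Y) ∧
    ∃ X ∈ O.circuits, Y = Set.indicator Aᶜ X}
  neg_mem := by
    rintro Y ⟨hY, X, hX, rfl⟩
    have hn : Function.support (-Set.indicator Aᶜ X) = Function.support (Set.indicator Aᶜ X) := by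
      ext e
      have h : ∀ s : SignType, -s ≠ 0 ↔ s ≠ 0 := by decide
      exact h _
    refine ⟨by rwa [hn], -X, O.neg_mem X hX, ?_⟩
    ext e
    by_cases he : e ∈ A <;> simp [he]
  isCircuit_iff := by
    intro C
    constructor
    · intro hC
      obtain ⟨C', hC', hCC', hC'A⟩ := hC.of_delete.exists_subset_isCircuit_of_contract
      have hCA : Disjoint C A := by
        have h := hC.of_delete.subset_ground
        rw [contract_ground] at h
        exact Set.disjoint_of_subset_left h Set.disjoint_sdiff_left
      obtain ⟨X, hX, rfl⟩ := (O.isCircuit_iff C').1 hC'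
      have hs : Function.support (Set.indicator Aᶜ X) = C := by
        rw [Set.support_indicator]
        ext e
        constructor
        · rintro ⟨he, heX⟩
          exact (hC'A heX).resolve_right he
        · intro he
          exact ⟨fun h => Set.disjoint_left.1 hCA he h, hCC' he⟩
      exact ⟨_, ⟨by rwa [hs], X, hX, rfl⟩, hs⟩
    · rintro ⟨Y, ⟨hY, -⟩, rfl⟩
      exact hY

end SignedCircuits

/-- A nonzero integer vector with entries in `{0, 1, -1}` and at most two nonzero entries. -/
def IsSmallVector (x : α → ℤ) : Prop :=
  x ≠ 0 ∧ (∀ e, x e = 0 ∨ x e = 1 ∨ x e = -1) ∧ (Function.support x).encard ≤ 2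

/-- `O` is generalized series parallel: every nonempty simple minor of `O` has a nonzero
`{0, 1, -1}`-coflow with at most two nonzero entries. -/
def Orientation.IsGSP {M : Matroid α} (O : M.Orientation) : Prop :=
  ∀ A B : Set α, ((M.contract A).delete B).E.Nonempty → ((M.contract A).delete B).IsSimple →
    ∃ x ∈ (O.toSignedCircuits.minor A B).coflowLattice, IsSmallVector x

/-- `O` is coGSP: every nonempty cosimple minor of `O` has a nonzero
`{0, 1, -1}`-flow with at most two nonzero entries. -/
def Orientation.IsCoGSP {M : Matroid α} (O : M.Orientation) : Prop :=
  ∀ A B : Set α, ((M.contract A).delete B).E.Nonempty → ((M.contract A).delete B).IsCosimple →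
    ∃ x ∈ (O.toSignedCircuits.minor A B).flowLattice, IsSmallVector x

end Matroid

namespace Matroid

variable {α : Type*} {M : Matroid α}

/-! ### Orthogonality of signed sets -/

/-! A simple one-element minor is a coloop, and its signed cocircuit is already small. Otherwise
take clones e, f of a simple minor `N`. Simplicity makes {e, f} independent, so some cocircuit D
contains e but not f, and the clone symmetry makes D - e + f a cocircuit as well. Contracting
everything outside D ∪ {f} leaves a loopless matroid of rank two in which e and f are each alone in
their parallel class, and whose cocircuits are cocircuits of `N`.

In rank two the signed cocircuits have a cyclic order. Neighbours, suitably signed, agree wherever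
both are nonzero, so their difference lives on their two zero classes. Such differences telescope
from the cocircuit vanishing at f to the one vanishing at e, leaving a 0, ±1 vector supported on {e,
f}. `exists_sign_mem_closure_of_line` does this without the cyclic order, by induction on the number
of elements where two cocircuits have opposite signs.

Signed cocircuits are defined by orthogonality, so their existence must be derived from circuit
elimination: `exists_signOrthogonal` contracts nonloops outside a cocircuit until only a parallel
class and loops remain, and `exists_mem_cocircuits_minor` passes to minors.

The core argument only needs signings of all circuits and all cocircuits that are mutually
orthogonal, the latter family closed under negation. Clones of a matroid are clones of its dual, so
exchanging the two families gives coGSP. -/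

lemma signOrthogonal_iff {X Y : α → SignType} :
    SignOrthogonal X Y ↔ ∀ e, X e * Y e ≠ 0 → ∃ f, X f * Y f = -(X e * Y e) := by
  have key : ∀ s : SignType, s ≠ 0 → s = 1 ∨ s = -1 := by decide
  constructor
  · rintro (h | ⟨⟨a, ha⟩, b, hb⟩) e he
    · exact absurd (h e) he
    · obtain h | h := key _ he
      · exact ⟨b, by rw [hb, h]⟩
      · exact ⟨a, by rw [ha, h, neg_neg]⟩
  · intro h
    by_cases h0 : ∀ e, X e * Y e = 0
    · exact Or.inl h0
    · push Not at h0
      obtain ⟨e, he⟩ := h0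
      obtain ⟨f, hf⟩ := h e he
      obtain h | h := key _ he
      · exact Or.inr ⟨⟨e, h⟩, f, by rw [hf, h]⟩
      · exact Or.inr ⟨⟨f, by rw [hf, h, neg_neg]⟩, e, h⟩

lemma SignOrthogonal.symm {X Y : α → SignType} (h : SignOrthogonal X Y) : SignOrthogonal Y X := by
  simpa only [SignOrthogonal, mul_comm] using h

lemma SignOrthogonal.neg_right {X Y : α → SignType} (h : SignOrthogonal X Y) :
    SignOrthogonal X (-Y) := by
  obtain h | ⟨⟨a, ha⟩, b, hb⟩ := h
  · exact Or.inl fun e => by rw [Pi.neg_apply, mul_neg, h e]; rfl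
  · exact Or.inr ⟨⟨b, by rw [Pi.neg_apply, mul_neg, hb, neg_neg]⟩, a, by
      rw [Pi.neg_apply, mul_neg, ha]⟩

lemma SignOrthogonal.congr {X Y X' Y' : α → SignType} (h : SignOrthogonal X Y)
    (h' : ∀ e, X' e * Y' e = X e * Y e) : SignOrthogonal X' Y' := by
  simpa only [SignOrthogonal, h'] using h

lemma SignOrthogonal.mul_eq_neg_mul {X Y : α → SignType} (h : SignOrthogonal X Y) {a b : α}
    (hab : ∀ g, g ≠ a → g ≠ b → X g * Y g = 0) : X a * Y a = -(X b * Y b) := by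
  rw [signOrthogonal_iff] at h
  have aux : ∀ s : SignType, s ≠ 0 → -s ≠ 0 ∧ s ≠ -s := by decide
  by_cases ha : X a * Y a = 0
  · by_contra hb
    have hb0 : X b * Y b ≠ 0 := fun h0 => hb (by rw [ha, h0]; rfl)
    obtain ⟨g, hg⟩ := h b hb0
    by_cases hga : g = a
    · subst hga; exact hb hg
    by_cases hgb : g = b
    · subst hgb; exact (aux _ hb0).2 hg
    · exact (aux _ hb0).1 (by rw [← hg, hab g hga hgb])
  · obtain ⟨g, hg⟩ := h a ha
    by_cases hga : g = a
    · subst hga; exact absurd hg (aux _ ha).2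
    by_cases hgb : g = b
    · subst hgb; rw [hg, neg_neg]
    · exact absurd (by rw [← hg, hab g hga hgb]) (aux _ ha).1

lemma support_neg_sign (X : α → SignType) : Function.support (-X) = Function.support X := by
  ext e
  have h : ∀ s : SignType, -s ≠ 0 ↔ s ≠ 0 := by decide
  exact h _

/-! ### Contraction of an orientation at a nonloop -/

namespace Orientation

variable (O : M.Orientation) {X Y W : α → SignType} {i e : α}

lemma isCircuit_support (hX : X ∈ O.circuits) : M.IsCircuit (Function.support X) :=
  (O.isCircuit_iff _).2 ⟨X, hX, rfl⟩

/-- Signed elimination for a pair of opposite signs, with a conformality conclusion. -/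
lemma exists_elimination (hX : X ∈ O.circuits) (hY : Y ∈ O.circuits) (hXY : X ≠ -Y)
    (he : X e * Y e = -1) :
    ∃ Z ∈ O.circuits, Z e = 0 ∧ ∀ g, Z g = 0 ∨ Z g = X g ∨ Z g = Y g := by
  have key : ∀ s t : SignType, s * t = -1 → (s = 1 ∧ t = -1) ∨ (t = 1 ∧ s = -1) := by decide
  have tri : ∀ z x y : SignType, (z = 1 → x = 1 ∨ y = 1) → (z = -1 → x = -1 ∨ y = -1) →
      z = 0 ∨ z = x ∨ z = y := by decide
  obtain ⟨h1, h2⟩ | ⟨h1, h2⟩ := key _ _ he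
  · obtain ⟨Z, hZ, hZe, hp, hn⟩ := O.elimination X hX Y hY hXY e h1 h2
    exact ⟨Z, hZ, hZe, fun g => tri _ _ _ (hp g) (hn g)⟩
  · obtain ⟨Z, hZ, hZe, hp, hn⟩ := O.elimination Y hY X hX
      (fun h => hXY (by rw [h, neg_neg])) e h1 h2
    exact ⟨Z, hZ, hZe, fun g => tri _ _ _ (fun h => (hp g h).symm) (fun h => (hn g h).symm)⟩

/-- Eliminating between `X` and `W` at a position where they have opposite signs keeps the support
inside supp X ∪ {i} and the sign at `i`, and strictly reduces the set of such positions. -/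
lemma exists_conformal_of_eq_one [M.Finitary] (hX : X ∈ O.circuits) (hXi : X i = 0)
    (hW : W ∈ O.circuits) (hWi : W i = 1)
    (hWX : Function.support W ⊆ insert i (Function.support X)) :
    ∃ V ∈ O.circuits, V i = 1 ∧ ∀ k, k ≠ i → V k = 0 ∨ V k = X k := by
  induction hn : {k | X k * W k = -1}.ncard using Nat.strong_induction_on generalizing W with
  | _ n ih =>
  by_cases hk : ∃ k, X k * W k = -1
  · obtain ⟨k, hk⟩ := hk
    have hXk : X k ≠ 0 := by rintro h; rw [h, zero_mul] at hk; exact absurd hk (by decide)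
    obtain ⟨Z, hZ, hZk, hZc⟩ := O.exists_elimination hX hW
      (fun h => by
        have := congrFun h i
        rw [hXi, Pi.neg_apply, hWi] at this
        exact absurd this (by decide)) hk
    have hsub : Function.support Z ⊆ insert i (Function.support X) := by
      intro g hg
      obtain h | h | h := hZc g
      · exact absurd h hg
      · exact Or.inr (by rw [Function.mem_support, ← h]; exact hg)
      · exact hWX (by rw [Function.mem_support, ← h]; exact hg)
    have hZi : Z i = 1 := by
      -- Otherwise `Z` lies inside supp X, hence is ±X, although it vanishes at `k`.
      have hne : Z i ≠ 0 := by
        intro h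
        have : Function.support Z ⊆ Function.support X := by
          intro g hg
          obtain rfl | h' := hsub hg
          · exact absurd h hg
          · exact h'
        obtain rfl | rfl := O.eq_or_eq_neg Z hZ X hX this
        · exact hXk hZk
        · have aux : ∀ s : SignType, -s = 0 → s = 0 := by decide
          exact hXk (aux _ hZk)
      have := hZc i
      rw [hXi, hWi] at this
      tauto
    refine ih _ ?_ hZ hZi hsub rfl
    rw [← hn]
    apply Set.ncard_lt_ncard
    · refine ⟨fun h hh => ?_, fun hsub' => ?_⟩
      · have aux : ∀ x z w : SignType, x * z = -1 → (z = 0 ∨ z = x ∨ z = w) → x * w = -1 := by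
          decide
        exact aux _ _ _ hh (hZc h)
      · have := hsub' hk
        rw [Set.mem_ofPred_eq, hZk, mul_zero] at this
        exact absurd this (by decide)
    · refine (O.isCircuit_support hX).finite.subset fun h hh h0 => ?_
      rw [Set.mem_ofPred_eq, h0, zero_mul] at hh
      exact absurd hh (by decide)
  · push Not at hk
    refine ⟨W, hW, hWi, fun k hki => ?_⟩
    have aux : ∀ x w : SignType, x * w ≠ -1 → (w ≠ 0 → x ≠ 0) → w = 0 ∨ w = x := by decide
    exact aux _ _ (hk k) fun hw => (hWX hw).resolve_left hki

/-- Completing `W` conformally to `X` gives `P`, and to `-X` gives `Q`, both positive at `i`. Either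
`P` or `-Q` serves unless both vanish at `e`; then eliminating `i` between `P` and `-Q` gives a
circuit inside supp X that misses `e`, which is impossible. -/
lemma exists_conformal_of_mem [M.Finitary] (hi : M.IsNonloop i) (hX : X ∈ O.circuits)
    (hXi : X i = 0) (hXe : X e ≠ 0) (hW : W ∈ O.circuits) (hWi : W i ≠ 0)
    (hWX : Function.support W ⊆ insert i (Function.support X)) :
    ∃ V ∈ O.circuits, V i ≠ 0 ∧ V e = X e ∧ ∀ k, k ≠ i → V k = 0 ∨ V k = X k := by
  have nz : ∀ s : SignType, -s = 0 ↔ s = 0 := by decide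
  have hei : e ≠ i := by rintro rfl; exact hXe hXi
  obtain ⟨W, hW, hWi, hWX⟩ : ∃ W ∈ O.circuits, W i = 1 ∧
      Function.support W ⊆ insert i (Function.support X) := by
    have key : ∀ s : SignType, s ≠ 0 → s = 1 ∨ -s = 1 := by decide
    obtain h | h := key _ hWi
    · exact ⟨W, hW, h, hWX⟩
    · exact ⟨-W, O.neg_mem W hW, h, by rwa [support_neg_sign]⟩
  obtain ⟨P, hP, hPi, hPX⟩ := O.exists_conformal_of_eq_one hX hXi hW hWi hWX
  obtain ⟨Q, hQ, hQi, hQX⟩ := O.exists_conformal_of_eq_one (O.neg_mem X hX)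
    ((nz _).2 hXi) hW hWi (by rwa [support_neg_sign])
  obtain hPe | hPe := hPX e hei
  swap
  · exact ⟨P, hP, by rw [hPi]; decide, hPe, hPX⟩
  obtain hQe | hQe := hQX e hei
  swap
  · refine ⟨-Q, O.neg_mem Q hQ, ?_, ?_, fun k hk => ?_⟩
    · rw [Pi.neg_apply, hQi]; decide
    · rw [Pi.neg_apply, hQe, Pi.neg_apply, neg_neg]
    · rw [Pi.neg_apply]
      obtain h | h := hQX k hk
      · left; rw [h]; rfl
      · right; rw [h, Pi.neg_apply, neg_neg]
  exfalso
  have hPQ : P ≠ -(-Q) := by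
    rw [neg_neg]
    rintro rfl
    have : Function.support P = {i} := by
      ext k
      by_cases hk : k = i
      · subst hk; simp [hPi]
      · have aux : ∀ p x : SignType, (p = 0 ∨ p = x) → (p = 0 ∨ p = -x) → p = 0 := by decide
        simp [hk, aux _ _ (hPX k hk) (hQX k hk)]
    have hl := O.isCircuit_support hP
    rw [this, singleton_isCircuit] at hl
    exact hi.not_isLoop hl
  obtain ⟨Z, hZ, hZi, hZc⟩ := O.exists_elimination (e := i) hP (O.neg_mem Q hQ) hPQ
    (by rw [Pi.neg_apply, hPi, hQi]; decide)
  have hsub : Function.support Z ⊆ Function.support X := by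
    intro k hk
    have hki : k ≠ i := by rintro rfl; exact hk hZi
    have aux : ∀ z p q x : SignType, z ≠ 0 → (z = 0 ∨ z = p ∨ z = -q) → (p = 0 ∨ p = x) →
        (q = 0 ∨ q = -x) → x ≠ 0 := by decide
    exact aux _ _ _ _ hk (hZc k) (hPX k hki) (hQX k hki)
  have hZe : Z e = 0 := by
    have := hZc e
    rw [Pi.neg_apply, hPe, hQe] at this
    simpa using this
  obtain rfl | rfl := O.eq_or_eq_neg Z hZ X hX hsub
  · exact hXe hZe
  · exact hXe ((nz _).1 hZe)

/-- Through every element of a signed circuit there is a signed circuit of the contraction that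
conforms to it. -/
lemma exists_conformal_contractElem [M.Finitary] (hi : M.IsNonloop i) (hX : X ∈ O.circuits)
    (hXe : X e ≠ 0) (hei : e ≠ i) :
    ∃ V ∈ O.circuits, (M ／ {i}).IsCircuit (Function.support V \ {i}) ∧ V e = X e ∧
      ∀ k, k ≠ i → V k = 0 ∨ V k = X k := by
  by_cases hc : (M ／ {i}).IsCircuit (Function.support X \ {i})
  · exact ⟨X, hX, hc, rfl, fun _ _ => Or.inr rfl⟩
  have hXi : X i = 0 := by
    by_contra h
    exact hc ((O.isCircuit_support hX).contractElem_isCircuit ⟨e, hXe, i, h, hei⟩ h)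
  have hdep : (M ／ {i}).Dep (Function.support X) :=
    (O.isCircuit_support hX).contract_dep (by simpa using hXi)
  obtain ⟨C, hCX, hC⟩ := hdep.exists_isCircuit_subset
  obtain ⟨C', hC', hCC', hC'i⟩ := hC.exists_subset_isCircuit_of_contract
  obtain ⟨W, hW, rfl⟩ := (O.isCircuit_iff _).1 hC'
  -- A lift avoiding `i` would have to be all of supp X, which would then be a circuit of the
  -- contraction.
  have hWi : W i ≠ 0 := by
    intro h
    have h1 : Function.support W ⊆ C := fun k hk =>
      (hC'i hk).resolve_right (by rintro rfl; exact hk h)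
    have h2 : Function.support W = Function.support X :=
      hC'.eq_of_subset_isCircuit (O.isCircuit_support hX) (h1.trans hCX)
    apply hc
    have h3 : C = Function.support X := hCX.antisymm (h2 ▸ h1)
    have h4 : Function.support X \ {i} = Function.support X := by
      apply Set.sdiff_singleton_eq_self
      simpa using hXi
    rw [h4, ← h3]
    exact hC
  obtain ⟨V, hV, hVi, hVe, hVX⟩ := O.exists_conformal_of_mem hi hX hXi hXe hW hWi
    (fun k hk => by
      obtain h | h := hC'i hk
      · exact Or.inr (hCX h)
      · exact Or.inl h)
  refine ⟨V, hV, (O.isCircuit_support hV).contractElem_isCircuit ⟨e, ?_, i, hVi, hei⟩ hVi, hVe, hVX⟩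
  rw [Function.mem_support, hVe]
  exact hXe

/-- The contraction of an orientation at a nonloop. -/
def contractElem [M.Finitary] (hi : M.IsNonloop i) : (M ／ {i}).Orientation where
  circuits := {Y | (M ／ {i}).IsCircuit (Function.support Y) ∧
    ∃ X ∈ O.circuits, Y = Set.indicator {i}ᶜ X}
  neg_mem := by
    rintro Y ⟨hY, X, hX, rfl⟩
    refine ⟨by rwa [support_neg_sign], -X, O.neg_mem X hX, ?_⟩
    ext e
    by_cases he : e = i <;> simp [he]
  isCircuit_iff := by
    intro C
    constructor
    · intro hC
      obtain ⟨C', hC', hCC', hC'i⟩ := hC.exists_subset_isCircuit_of_contract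
      obtain ⟨X, hX, rfl⟩ := (O.isCircuit_iff C').1 hC'
      have hs : Function.support (Set.indicator {i}ᶜ X) = C := by
        rw [Set.support_indicator]
        ext e
        constructor
        · rintro ⟨he, heX⟩
          exact (hC'i heX).resolve_right he
        · intro he
          exact ⟨(hC.subset_ground he).2, hCC' he⟩
      exact ⟨_, ⟨by rwa [hs], X, hX, rfl⟩, hs⟩
    · rintro ⟨Y, ⟨hY, -⟩, rfl⟩
      exact hY
  eq_or_eq_neg := by
    rintro _ ⟨hX', X, hX, rfl⟩ _ ⟨hY', Y, hY, rfl⟩ hsub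
    have hs := hX'.eq_of_subset_isCircuit hY' hsub
    simp only [Set.support_indicator] at hs
    have hs' : Function.support X ⊆ Function.support Y ∨
        Function.support Y ⊆ Function.support X := by
      by_cases hXi : X i = 0
      · left
        intro k hk
        have : k ∈ ({i}ᶜ : Set α) ∩ Function.support X :=
          ⟨by rintro rfl; exact hk hXi, hk⟩
        rw [hs] at this
        exact this.2
      · right
        intro k hk
        by_cases hki : k = i
        · subst hki; exact hXi
        have : k ∈ ({i}ᶜ : Set α) ∩ Function.support Y := ⟨hki, hk⟩
        rw [← hs] at this
        exact this.2
    obtain h | h : X = Y ∨ X = -Y := by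
      obtain h | h := hs'
      · exact O.eq_or_eq_neg X hX Y hY h
      · obtain h | h := O.eq_or_eq_neg Y hY X hX h
        · exact Or.inl h.symm
        · exact Or.inr (by rw [h, neg_neg])
    · exact Or.inl (by rw [h])
    · right
      rw [h]
      ext e
      by_cases he : e = i <;> simp [he]
  elimination := by
    rintro _ ⟨hX', X, hX, rfl⟩ _ ⟨hY', Y, hY, rfl⟩ hXY e hXe hYe
    have hei : e ≠ i := by
      rintro rfl
      simp at hXe
    have hind : ∀ (V : α → SignType) k, k ≠ i → Set.indicator {i}ᶜ V k = V k :=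
      fun V k hk => Set.indicator_of_mem (by simpa using hk) V
    have hind' : ∀ (V : α → SignType), Set.indicator {i}ᶜ V i = 0 :=
      fun V => by simp
    rw [hind _ _ hei] at hXe hYe
    obtain ⟨Z, hZ, hZe, hp, hn⟩ := O.elimination X hX Y hY (by
      rintro rfl
      apply hXY
      ext e
      by_cases he : e = i <;> simp [he]) e hXe hYe
    -- The support of `Z` minus `i` need not be a circuit of the contraction, but a conformal
    -- circuit through any of its elements is one and inherits the sign conditions.
    obtain ⟨g, hg, hgi⟩ : ∃ g, Z g ≠ 0 ∧ g ≠ i := by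
      by_contra! hcon
      have hsub : Function.support Z ⊆ {i} := fun g hg => hcon g hg
      have hZc := O.isCircuit_support hZ
      rw [(Set.subset_singleton_iff_eq.1 hsub).resolve_left hZc.nonempty.ne_empty,
        singleton_isCircuit] at hZc
      exact hi.not_isLoop hZc
    obtain ⟨V, hV, hVc, hVg, hVZ⟩ := O.exists_conformal_contractElem hi hZ hg hgi
    refine ⟨Set.indicator {i}ᶜ V, ⟨?_, V, hV, rfl⟩, ?_, fun k hk => ?_, fun k hk => ?_⟩
    · rw [Set.support_indicator, Set.inter_comm]
      exact hVc
    · rw [hind _ _ hei]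
      obtain h | h := hVZ e hei
      · exact h
      · rw [h, hZe]
    · have hki : k ≠ i := by rintro rfl; rw [hind'] at hk; exact absurd hk (by decide)
      rw [hind _ _ hki] at hk ⊢
      rw [hind _ _ hki]
      obtain h | h := hVZ k hki
      · rw [h] at hk; exact absurd hk (by decide)
      · exact hp k (h ▸ hk)
    · have hki : k ≠ i := by rintro rfl; rw [hind'] at hk; exact absurd hk (by decide)
      rw [hind _ _ hki] at hk ⊢
      rw [hind _ _ hki]
      obtain h | h := hVZ k hki
      · rw [h] at hk; exact absurd hk (by decide)
      · exact hn k (h ▸ hk)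

end Orientation

/-! ### Existence of signed cocircuits -/

/-- A cocircuit all of whose complement consists of loops is a parallel class. -/
lemma IsCocircuit.isCircuit_pair_of_forall_isLoop {D : Set α} (hD : M.IsCocircuit D)
    (hl : ∀ g ∈ M.E \ D, M.IsLoop g) {e f : α} (he : e ∈ D) (hf : f ∈ D) (hef : e ≠ f) :
    M.IsCircuit {e, f} := by
  have hen := hD.isNonloop_of_mem he
  rw [← hen.closure_eq_closure_iff_isCircuit_of_ne hef,
    hen.closure_eq_closure_iff_eq_or_dep (hD.isNonloop_of_mem hf)]
  right
  intro hI
  obtain ⟨K, hK, hKe⟩ := hI.exists_isCocircuit_inter_eq_mem (e := e) (by simp)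
  have hKD : K ⊆ D := fun g hg => by
    by_contra hgD
    exact (hK.isNonloop_of_mem hg).not_isLoop (hl g ⟨hK.subset_ground hg, hgD⟩)
  have hfK : f ∈ K ∩ {e, f} := by
    rw [IsCircuit.eq_of_subset_isCircuit hK hD hKD]
    exact ⟨hf, by simp⟩
  rw [hKe] at hfK
  exact hef hfK.symm

namespace Orientation

variable (O : M.Orientation)

lemma mul_eq_mul_of_support_eq {X Y : α → SignType} (hX : X ∈ O.circuits) (hY : Y ∈ O.circuits)
    (h : Function.support X = Function.support Y) (a b : α) : X a * X b = Y a * Y b := by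
  obtain rfl | rfl := O.eq_or_eq_neg X hX Y hY h.subset
  · rfl
  · simp

/-- Here `D` is a parallel class. Orthogonality to the two-element circuits through a fixed `e₀`
forces the signing; elimination shows that it also suits every other pair in `D`, and a circuit
meeting `D` is such a pair. -/
lemma exists_signOrthogonal_of_forall_isLoop {D : Set α} (hD : M.IsCocircuit D)
    (hl : ∀ g ∈ M.E \ D, M.IsLoop g) :
    ∃ Y : α → SignType, Function.support Y = D ∧ ∀ X ∈ O.circuits, SignOrthogonal X Y := by
  classical
  obtain ⟨e₀, he₀⟩ := hD.nonempty
  have hex : ∀ e, ∃ X : α → SignType, e ∈ D → e ≠ e₀ →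
      X ∈ O.circuits ∧ Function.support X = {e₀, e} ∧ X e₀ = 1 := by
    intro e
    by_cases he : e ∈ D ∧ e ≠ e₀
    · obtain ⟨X, hX, hXs⟩ := (O.isCircuit_iff _).1
        (hD.isCircuit_pair_of_forall_isLoop hl he₀ he.1 he.2.symm)
      have h0 : X e₀ ≠ 0 := by
        have : e₀ ∈ Function.support X := by rw [hXs]; simp
        exact this
      have key : ∀ s : SignType, s ≠ 0 → s = 1 ∨ -s = 1 := by decide
      obtain h | h := key _ h0
      · exact ⟨X, fun _ _ => ⟨hX, hXs, h⟩⟩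
      · exact ⟨-X, fun _ _ => ⟨O.neg_mem X hX, by rw [support_neg_sign, hXs], h⟩⟩
    · exact ⟨0, fun h1 h2 => absurd ⟨h1, h2⟩ he⟩
  choose S hS using hex
  have hSe : ∀ e, e ∈ D → e ≠ e₀ → S e e ≠ 0 := fun e he hne => by
    have : e ∈ Function.support (S e) := by rw [(hS e he hne).2.1]; simp
    exact this
  have hSz : ∀ e, e ∈ D → e ≠ e₀ → ∀ g, g ≠ e₀ → g ≠ e → S e g = 0 := fun e he hne g h1 h2 => by
    have : g ∉ Function.support (S e) := by rw [(hS e he hne).2.1]; simp [h1, h2]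
    simpa using this
  set Y : α → SignType := fun e => if e ∈ D then (if e = e₀ then 1 else -(S e e)) else 0 with hY
  have nz : ∀ s : SignType, s ≠ 0 → -s ≠ 0 := by decide
  have hY0 : Y e₀ = 1 := by simp [hY, he₀]
  have hYe : ∀ e, e ∈ D → e ≠ e₀ → Y e = -(S e e) := fun e he hne => by simp [hY, he, hne]
  have hYD : Function.support Y = D := by
    ext e
    by_cases he : e ∈ D
    · simp only [Function.mem_support, he, iff_true]
      by_cases hne : e = e₀
      · rw [hne, hY0]; decide
      · rw [hYe e he hne]; exact nz _ (hSe e he hne)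
    · simp [hY, he]
  have h0 : ∀ X ∈ O.circuits, ∀ f ∈ D, f ≠ e₀ → Function.support X = {e₀, f} →
      X e₀ * X f = -(Y e₀ * Y f) := by
    intro X hX f hf hne hXs
    rw [O.mul_eq_mul_of_support_eq hX (hS f hf hne).1 (by rw [hXs, (hS f hf hne).2.1]),
      (hS f hf hne).2.2, hY0, hYe f hf hne, one_mul, one_mul, neg_neg]
  have hpair : ∀ X ∈ O.circuits, ∀ e ∈ D, ∀ f ∈ D, e ≠ f → Function.support X = {e, f} →
      X e * X f = -(Y e * Y f) := by
    intro X hX e he f hf hef hXs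
    by_cases h1 : e = e₀
    · subst h1; exact h0 X hX f hf hef.symm hXs
    by_cases h2 : f = e₀
    · subst h2
      rw [mul_comm, mul_comm (Y e)]
      exact h0 X hX e he hef (by rw [hXs, Set.pair_comm])
    obtain ⟨hSeO, hSes, hSe0⟩ := hS e he h1
    obtain ⟨hSfO, hSfs, hSf0⟩ := hS f hf h2
    -- Eliminating `e₀` leaves a circuit on {e, f} with signs `S e e` and `-(S f f)`, exactly what
    -- orthogonality to `Y` requires.
    obtain ⟨Z, hZ, hZ0, hZc⟩ := O.exists_elimination (e := e₀) hSeO (O.neg_mem _ hSfO) (by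
      rw [neg_neg]
      intro h
      apply hSe e he h1
      rw [h]
      exact hSz f hf h2 e h1 hef) (by
      rw [hSe0, Pi.neg_apply, hSf0]; decide)
    have hsub : Function.support Z ⊆ Function.support X := by
      intro g hg
      rw [hXs]
      by_contra hgef
      simp only [Set.mem_insert_iff, Set.mem_singleton_iff, not_or] at hgef
      have hg0 : g ≠ e₀ := by rintro rfl; exact hg hZ0
      have := hZc g
      rw [Pi.neg_apply, hSz e he h1 g hg0 hgef.1, hSz f hf h2 g hg0 hgef.2] at this
      exact hg (by simpa using this)
    have hs := (O.isCircuit_support hX).eq_of_superset_isCircuit (O.isCircuit_support hZ) hsub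
    rw [O.mul_eq_mul_of_support_eq hX hZ hs, hYe e he h1, hYe f hf h2]
    have hmem : ∀ g, g = e ∨ g = f → Z g ≠ 0 := fun g hg => by
      have : g ∈ Function.support Z := by rw [← hs, hXs]; simpa using hg
      exact this
    have c1 := (hZc e).resolve_left (hmem e (Or.inl rfl))
    have c2 := (hZc f).resolve_left (hmem f (Or.inr rfl))
    rw [Pi.neg_apply, hSz f hf h2 e h1 hef] at c1
    rw [Pi.neg_apply, hSz e he h1 f h2 hef.symm] at c2
    have c1' := c1.resolve_right (by simpa using hmem e (Or.inl rfl))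
    have c2' := c2.resolve_left (hmem f (Or.inr rfl))
    rw [c1', c2']
    simp
  refine ⟨Y, hYD, fun X hX => signOrthogonal_iff.2 fun e he => ?_⟩
  have heD : e ∈ D := by
    rw [← hYD]; intro h; rw [h, mul_zero] at he; exact he rfl
  have heX : e ∈ Function.support X := by
    intro h; rw [h, zero_mul] at he; exact he rfl
  have hXc := O.isCircuit_support hX
  obtain ⟨f, hf, hfe⟩ := (hXc.isCocircuit_inter_nontrivial hD ⟨e, heX, heD⟩).exists_ne e
  have hXs : {f, e} = Function.support X :=
    (hD.isCircuit_pair_of_forall_isLoop hl hf.2 heD hfe).eq_of_subset_isCircuit hXc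
      (by rintro g (rfl | rfl); exacts [hf.1, heX])
  refine ⟨f, ?_⟩
  have := hpair X hX f hf.2 e heD hfe hXs.symm
  have aux : ∀ a b c d : SignType, a * b = -(c * d) → c ≠ 0 → b * d ≠ 0 → a * c = -(b * d) := by
    decide
  have hYf : f ∈ Function.support Y := hYD ▸ hf.2
  exact aux _ _ _ _ this hYf he

/-- Every cocircuit has a signing that is orthogonal to all signed circuits. -/
theorem exists_signOrthogonal [M.Finite] {D : Set α} (hD : M.IsCocircuit D) :
    ∃ Y : α → SignType, Function.support Y = D ∧ ∀ X ∈ O.circuits, SignOrthogonal X Y := by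
  induction hn : (M.E \ D).ncard using Nat.strong_induction_on generalizing M with
  | _ n ih =>
  by_cases hi : ∃ i ∈ M.E \ D, M.IsNonloop i
  · obtain ⟨i, ⟨hiE, hiD⟩, hi⟩ := hi
    have hD' : (M ／ {i}).IsCocircuit D := by
      rw [contract_isCocircuit_iff]
      exact ⟨hD, by simpa using hiD⟩
    obtain ⟨Y, hYD, hY⟩ := ih _ (by
      rw [← hn]
      apply Set.ncard_lt_ncard _ (M.ground_finite.sdiff)
      refine ⟨Set.sdiff_subset_sdiff_left (Set.sdiff_subset), fun h => ?_⟩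
      exact (h ⟨hiE, hiD⟩).1.2 rfl) (O.contractElem hi) hD' rfl
    refine ⟨Y, hYD, fun X hX => signOrthogonal_iff.2 fun e he => ?_⟩
    have hXe : X e ≠ 0 := by rintro h; rw [h, zero_mul] at he; exact he rfl
    have heD : e ∈ D := by
      rw [← hYD]; intro h; rw [h, mul_zero] at he; exact he rfl
    have hei : e ≠ i := by rintro rfl; exact hiD heD
    -- Orthogonality is tested one element at a time: `V` agrees with `X` at `e`, and an element
    -- balancing `e` for `V` is in the support of `V` and differs from `i`, so `X` has the same sign
    -- there.
    obtain ⟨V, hV, hVc, hVe, hVX⟩ := O.exists_conformal_contractElem hi hX hXe hei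
    have hind : ∀ k, k ≠ i → Set.indicator {i}ᶜ V k = V k :=
      fun k hk => Set.indicator_of_mem (by simpa using hk) V
    have horth := signOrthogonal_iff.1 (hY (Set.indicator {i}ᶜ V)
      ⟨by rw [Set.support_indicator, Set.inter_comm]; exact hVc, V, hV, rfl⟩) e
    rw [hind e hei, hVe] at horth
    obtain ⟨f, hf⟩ := horth he
    have hfi : f ≠ i := by
      rintro rfl
      rw [Set.indicator_of_notMem (by simp), zero_mul] at hf
      have aux : ∀ s : SignType, s ≠ 0 → -s ≠ 0 := by decide
      exact aux _ he hf.symm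
    rw [hind f hfi] at hf
    obtain h | h := hVX f hfi
    · rw [h, zero_mul] at hf
      have aux : ∀ s : SignType, s ≠ 0 → -s ≠ 0 := by decide
      exact absurd hf.symm (aux _ he)
    · exact ⟨f, h ▸ hf⟩
  · push Not at hi
    exact O.exists_signOrthogonal_of_forall_isLoop hD fun g hg =>
      (not_isNonloop_iff hg.1).1 (hi g hg)

/-- Every cocircuit of a minor carries a signed cocircuit of the minor. -/
theorem exists_mem_cocircuits_minor [M.Finite] (A B : Set α) {K : Set α}
    (hK : ((M ／ A) ＼ B).IsCocircuit K) :
    ∃ Y ∈ (O.toSignedCircuits.minor A B).cocircuits, Function.support Y = K := by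
  have hKE := hK.subset_ground
  have hKd := hK
  rw [isCocircuit_def, dual_delete] at hKd
  obtain ⟨K', hK', hKK', hK'B⟩ := hKd.exists_subset_isCircuit_of_contract
  have hK'' := contract_isCocircuit_iff.1 hK'
  obtain ⟨Y, rfl, hY⟩ := O.exists_signOrthogonal hK''.1
  have hs : Function.support (Set.indicator Bᶜ Y) = K := by
    rw [Set.support_indicator]
    ext e
    refine ⟨fun he => (hK'B he.2).resolve_right he.1, fun he => ⟨(hKE he).2, hKK' he⟩⟩
  refine ⟨_, ⟨by rwa [hs], ?_⟩, hs⟩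
  rintro _ ⟨hX', X, hX, rfl⟩
  -- The two restrictions lose nothing: `Y` vanishes on `A`, and `X` vanishes on `B` outside `A`.
  refine (hY X hX).congr fun e => ?_
  by_cases heA : e ∈ A
  · have : Y e = 0 := by
      by_contra h
      exact Set.disjoint_left.1 hK''.2 h heA
    by_cases heB : e ∈ B <;> simp [heA, heB, this]
  · by_cases heB : e ∈ B
    · have : X e = 0 := by
        by_contra h
        exact (hX'.subset_ground (a := e) (by simp [heA, h])).2 heB
      simp [heA, heB, this]
    · simp [heA, heB]

end Orientation
end Matroid

namespace Matroid

variable {α : Type*}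

/-! ### Small vectors in lines -/

/-- For two signed cocircuits `X`, `Y` in a line (a loopless rank two matroid whose parallel
classes are the fibres of `κ`), the vector supported on the zero classes of `X` and `Y`, equal
to `Y` on the former and to `±X` on the latter, is an integer combination of signed cocircuits. -/
lemma exists_sign_mem_closure_of_line {ι : Type*} {E : Set α} (hE : E.Finite) (κ : α → ι)
    {𝒞 𝒟 : Set (α → SignType)} (horth : ∀ X ∈ 𝒞, ∀ Y ∈ 𝒟, SignOrthogonal X Y)
    (hneg : ∀ Y ∈ 𝒟, -Y ∈ 𝒟)
    (hpair : ∀ a ∈ E, ∀ b ∈ E, a ≠ b → κ a = κ b → ∃ C ∈ 𝒞, Function.support C = {a, b})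
    (htriple : ∀ a ∈ E, ∀ b ∈ E, ∀ c ∈ E, κ a ≠ κ b → κ a ≠ κ c → κ b ≠ κ c →
      ∃ C ∈ 𝒞, Function.support C = {a, b, c})
    (hcoc : ∀ g ∈ E, ∃ Y ∈ 𝒟, Function.support Y = {h ∈ E | κ h ≠ κ g})
    {a b : α} (ha : a ∈ E) (hb : b ∈ E) (hab : κ a ≠ κ b) {X Y : α → SignType}
    (hX : X ∈ 𝒟) (hXs : Function.support X = {h ∈ E | κ h ≠ κ a})
    (hY : Y ∈ 𝒟) (hYs : Function.support Y = {h ∈ E | κ h ≠ κ b}) :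
    ∃ ε : ℤ, (ε = 1 ∨ ε = -1) ∧
      (fun h => if X h = 0 then (Y h : ℤ) else if Y h = 0 then ε * (X h : ℤ) else 0) ∈
        AddSubgroup.closure ((fun (X : α → SignType) e => (X e : ℤ)) '' 𝒟) := by
  have hzero : ∀ {V : α → SignType} {c : α}, Function.support V = {h ∈ E | κ h ≠ κ c} →
      ∀ h ∈ E, (V h = 0 ↔ κ h = κ c) := by
    intro V c hV h hh
    have : h ∈ Function.support V ↔ κ h ≠ κ c := by rw [hV]; simp [hh]
    rw [Function.mem_support] at this
    tauto
  have hout : ∀ {V : α → SignType} {c : α}, Function.support V = {h ∈ E | κ h ≠ κ c} →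
      ∀ h, h ∉ E → V h = 0 := by
    intro V c hV h hh
    have : h ∉ Function.support V := by rw [hV]; simp [hh]
    simpa using this
  induction hn : {h | X h * Y h = -1}.ncard using Nat.strong_induction_on
    generalizing a b X Y with
  | _ n ih =>
  have mem : ∀ V ∈ 𝒟, (fun e => (V e : ℤ)) ∈
      AddSubgroup.closure ((fun (X : α → SignType) e => (X e : ℤ)) '' 𝒟) :=
    fun V hV => AddSubgroup.subset_closure ⟨V, hV, rfl⟩
  by_cases hsep : ∃ g, X g * Y g = -1
  swap
  · push Not at hsep
    -- With no opposite signs, `Y - X` cancels on the common support.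
    refine ⟨-1, Or.inr rfl, ?_⟩
    convert! AddSubgroup.sub_mem _ (mem Y hY) (mem X hX) using 1
    ext h
    have aux : ∀ x y : SignType, x * y ≠ -1 →
        (if x = 0 then (y : ℤ) else if y = 0 then -1 * (x : ℤ) else 0) = (y : ℤ) - (x : ℤ) := by
      decide
    exact aux _ _ (hsep h)
  obtain ⟨g, hg⟩ := hsep
  have hXg : X g ≠ 0 := by rintro h; rw [h, zero_mul] at hg; exact absurd hg (by decide)
  have hYg : Y g ≠ 0 := by rintro h; rw [h, mul_zero] at hg; exact absurd hg (by decide)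
  have hgE : g ∈ E := by by_contra h; exact hXg (hout hXs g h)
  have hga : κ g ≠ κ a := fun h => hXg ((hzero hXs g hgE).2 h)
  have hgb : κ g ≠ κ b := fun h => hYg ((hzero hYs g hgE).2 h)
  -- signs of the three cocircuits along a triangle
  have two : ∀ {C : α → SignType} {p q r : α}, Function.support C = {p, q, r} → C ∈ 𝒞 →
      ∀ V ∈ 𝒟, V p = 0 → C q * V q = -(C r * V r) := by
    intro C p q r hC hC𝒞 V hV hVp
    apply (horth C hC𝒞 V hV).mul_eq_neg_mul
    intro k hkq hkr
    by_cases hkp : k = p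
    · rw [hkp, hVp, mul_zero]
    · have : k ∉ Function.support C := by rw [hC]; simp [hkp, hkq, hkr]
      rw [Function.notMem_support.1 this, zero_mul]
  have cz : ∀ {C : α → SignType} {S : Set α}, Function.support C = S → ∀ k ∈ S, C k ≠ 0 := by
    rintro C S rfl k hk; exact hk
  -- a cocircuit vanishing at `g` can be scaled to agree with `Y` at `a` and `X` at `b`
  obtain ⟨Z₀, hZ₀, hZ₀s⟩ := hcoc g hgE
  -- On the triangle {a', b', g} each of `X`, `Y`, `Z` vanishes at one vertex, so orthogonality
  -- relates its signs at the other two. Combining the three relations with `X g * Y g = -1` gives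
  -- the claim.
  have hrel : ∀ Z ∈ 𝒟, Function.support Z = {h ∈ E | κ h ≠ κ g} →
      ∀ a' ∈ E, κ a' = κ a → ∀ b' ∈ E, κ b' = κ b → Z a' * Y a' = Z b' * X b' := by
    intro Z hZ hZs a' ha' haa b' hb' hbb
    obtain ⟨C, hC, hCs⟩ := htriple a' ha' b' hb' g hgE (by rwa [haa, hbb])
      (by rw [haa]; exact hga.symm) (by rw [hbb]; exact hgb.symm)
    have h1 := two hCs hC X hX ((hzero hXs a' ha').2 haa)
    have h2 := two (by rw [hCs, Set.insert_comm]) hC Y hY ((hzero hYs b' hb').2 hbb)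
    have h3 := two (p := g) (q := a') (r := b')
      (by rw [hCs, Set.pair_comm b' g, Set.insert_comm]) hC Z hZ ((hzero hZs g hgE).2 rfl)
    have c1 := cz hCs a' (by simp)
    have c2 := cz hCs b' (by simp)
    have c3 := cz hCs g (by simp)
    have e1 : C b' * X b' = -(C a' * Y a') := by
      have aux : ∀ p q c x y : SignType, p = -(c * x) → q = -(c * y) → x * y = -1 → p = -q := by
        decide
      exact aux _ _ _ _ _ h1 h2 hg
    revert h3 e1 c1 c2
    generalize C a' = c, C b' = d, Z a' = z, Z b' = w, X b' = x, Y a' = y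
    revert c d z w x y
    decide
  obtain ⟨Z, hZ, hZs, hZa⟩ : ∃ Z ∈ 𝒟, Function.support Z = {h ∈ E | κ h ≠ κ g} ∧ Z a = Y a := by
    have h1 : Z₀ a ≠ 0 := fun h => hga.symm ((hzero hZ₀s a ha).1 h)
    have h2 : Y a ≠ 0 := fun h => hab ((hzero hYs a ha).1 h)
    have aux : ∀ s t : SignType, s ≠ 0 → t ≠ 0 → s = t ∨ -s = t := by decide
    obtain h | h := aux _ _ h1 h2
    · exact ⟨Z₀, hZ₀, hZ₀s, h⟩
    · exact ⟨-Z₀, hneg _ hZ₀, by rw [support_neg_sign, hZ₀s], h⟩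
  have sq : ∀ s t : SignType, t ≠ 0 → (s * t = 1 ↔ s = t) := by decide
  have hYa : Y a ≠ 0 := fun h => hab ((hzero hYs a ha).1 h)
  have hZb : ∀ b' ∈ E, κ b' = κ b → Z b' = X b' := by
    intro b' hb' hbb
    have hXb : X b' ≠ 0 := fun h => hab (((hzero hXs b' hb').1 h).symm.trans hbb)
    rw [← sq _ _ hXb, ← hrel Z hZ hZs a ha rfl b' hb' hbb, sq _ _ hYa, hZa]
  have hZa' : ∀ a' ∈ E, κ a' = κ a → Z a' = Y a' := by
    intro a' ha' haa
    have hYa' : Y a' ≠ 0 := fun h => hab (haa.symm.trans ((hzero hYs a' ha').1 h))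
    have hXb : X b ≠ 0 := fun h => hab ((hzero hXs b hb).1 h).symm
    rw [← sq _ _ hYa', hrel Z hZ hZs a' ha' haa b hb rfl, sq _ _ hXb, hZb b hb rfl]
  have hXYg : ∀ h ∈ E, κ h = κ g → Y h = -X h := by
    intro h hh hhg
    by_cases hne : h = g
    · subst hne
      have aux : ∀ s t : SignType, s * t = -1 → t = -s := by decide
      exact aux _ _ hg
    obtain ⟨C, hC, hCs⟩ := hpair h hh g hgE hne hhg
    have hd : ∀ V ∈ 𝒟, C h * V h = -(C g * V g) := fun V hV => by
      apply (horth C hC V hV).mul_eq_neg_mul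
      intro k h1 h2
      have : k ∉ Function.support C := by rw [hCs]; simp [h1, h2]
      rw [Function.notMem_support.1 this, zero_mul]
    have h1 := hd X hX
    have h2 := hd Y hY
    have c1 := cz hCs h (by simp)
    revert h1 h2 c1 hg
    generalize C h = c, C g = d, X h = x, X g = x', Y h = y, Y g = y'
    revert c d x x' y y'
    decide
  -- away from the three classes `Z` conforms to `X` and `Y`
  have hconf : ∀ h, X h * Y h = 1 → Z h = 0 ∨ Z h = X h := by
    intro h hh
    have hXh : X h ≠ 0 := by rintro h'; rw [h', zero_mul] at hh; exact absurd hh (by decide)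
    have hYh : Y h ≠ 0 := by rintro h'; rw [h', mul_zero] at hh; exact absurd hh (by decide)
    have hhE : h ∈ E := by by_contra h'; exact hXh (hout hXs h h')
    have hha : κ h ≠ κ a := fun h' => hXh ((hzero hXs h hhE).2 h')
    have hhb : κ h ≠ κ b := fun h' => hYh ((hzero hYs h hhE).2 h')
    obtain ⟨C, hC, hCs⟩ := htriple a ha b hb h hhE hab hha.symm hhb.symm
    have h1 := two hCs hC X hX ((hzero hXs a ha).2 rfl)
    have h2 := two (by rw [hCs, Set.insert_comm]) hC Y hY ((hzero hYs b hb).2 rfl)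
    by_contra! hcon
    have hZh : Z h = -X h := by
      have aux : ∀ z x : SignType, z ≠ 0 → z ≠ x → x ≠ 0 → z = -x := by decide
      exact aux _ _ hcon.1 hcon.2 hXh
    have hYX : Y h = X h := by
      have aux : ∀ x y : SignType, x * y = 1 → y = x := by decide
      exact aux _ _ hh
    have c3 : C h * X h ≠ 0 := by
      have aux : ∀ x y : SignType, x ≠ 0 → y ≠ 0 → x * y ≠ 0 := by decide
      exact aux _ _ (cz hCs h (by simp)) hXh
    -- If `Z` were opposite to `X` at `h`, its products with `C` would have the same sign at all
    -- three vertices.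
    have ea : C a * Z a = -(C h * X h) := by rw [hZa, h2, hYX]
    have eb : C b * Z b = -(C h * X h) := by rw [hZb b hb rfl, h1]
    have eh : C h * Z h = -(C h * X h) := by rw [hZh, mul_neg]
    obtain ⟨k, hk⟩ := signOrthogonal_iff.1 (horth C hC Z hZ) h (by
      rw [eh]; revert c3; generalize C h * X h = s; revert s; decide)
    rw [eh, neg_neg] at hk
    have nn : ∀ s : SignType, s ≠ 0 → -s ≠ s := by decide
    by_cases hkC : k ∈ Function.support C
    · rw [hCs] at hkC
      obtain rfl | rfl | rfl := hkC
      · exact nn _ c3 (ea.symm.trans hk)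
      · exact nn _ c3 (eb.symm.trans hk)
      · exact nn _ c3 (eh.symm.trans hk)
    · rw [Function.notMem_support.1 hkC, zero_mul] at hk
      exact c3 hk.symm
  have hfin : {h | X h * Y h = -1}.Finite := hE.subset fun h hh => by
    by_contra h'
    rw [Set.mem_ofPred_eq, hout hXs h h', zero_mul] at hh
    exact absurd hh (by decide)
  have hZg : Z g = 0 := (hzero hZs g hgE).2 rfl
  have cases : ∀ h, (h ∉ E ∧ X h = 0 ∧ Y h = 0 ∧ Z h = 0) ∨
      (X h = 0 ∧ Y h ≠ 0 ∧ Z h = Y h) ∨ (X h ≠ 0 ∧ Y h = 0 ∧ Z h = X h) ∨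
      (X h ≠ 0 ∧ Y h = -X h ∧ Z h = 0) ∨ (X h ≠ 0 ∧ Y h ≠ 0 ∧ Z h ≠ 0) := by
    intro h
    by_cases hh : h ∈ E
    swap
    · exact Or.inl ⟨hh, hout hXs h hh, hout hYs h hh, hout hZs h hh⟩
    right
    by_cases h1 : κ h = κ a
    · exact Or.inl ⟨(hzero hXs h hh).2 h1,
        fun h' => hab (h1.symm.trans ((hzero hYs h hh).1 h')), hZa' h hh h1⟩
    have hXh : X h ≠ 0 := fun h' => h1 ((hzero hXs h hh).1 h')
    right
    by_cases h2 : κ h = κ b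
    · exact Or.inl ⟨hXh, (hzero hYs h hh).2 h2, hZb h hh h2⟩
    right
    by_cases h3 : κ h = κ g
    · exact Or.inl ⟨hXh, hXYg h hh h3, (hzero hZs h hh).2 h3⟩
    · exact Or.inr ⟨hXh, fun h' => h2 ((hzero hYs h hh).1 h'),
        fun h' => h3 ((hzero hZs h hh).1 h')⟩
  -- Elements separating `X` from `Z` also separate `X` from `Y`, by `hconf` and the class-by-class
  -- comparison, while `g` no longer does since `Z` vanishes there.
  obtain ⟨ε₁, hε₁, hv₁⟩ := ih {h | X h * Z h = -1}.ncard (by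
    rw [← hn]
    refine Set.ncard_lt_ncard ⟨fun h hh => ?_, fun hs => ?_⟩ hfin
    · rw [Set.mem_ofPred_eq] at hh ⊢
      have h2 := hconf h
      have h3 := cases h
      revert hh h2 h3
      generalize X h = x, Y h = y, Z h = z
      rintro hh h2 (⟨-, h3⟩ | h3)
      · revert x y z; decide
      · revert x y z; decide
    · have := hs hg
      rw [Set.mem_ofPred_eq, hZg, mul_zero] at this
      exact absurd this (by decide)) ha hgE hga.symm hX hXs hZ hZs rfl
  obtain ⟨ε₂, hε₂, hv₂⟩ := ih {h | Z h * Y h = -1}.ncard (by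
    rw [← hn]
    refine Set.ncard_lt_ncard ⟨fun h hh => ?_, fun hs => ?_⟩ hfin
    · rw [Set.mem_ofPred_eq] at hh ⊢
      have h2 := hconf h
      have h3 := cases h
      revert hh h2 h3
      generalize X h = x, Y h = y, Z h = z
      rintro hh h2 (⟨-, h3⟩ | h3)
      · revert x y z; decide
      · revert x y z; decide
    · have := hs hg
      rw [Set.mem_ofPred_eq, hZg, zero_mul] at this
      exact absurd this (by decide)) hgE hb hgb hZ hZs hY hYs rfl
  refine ⟨ε₁ * ε₂, by obtain rfl | rfl := hε₁ <;> obtain rfl | rfl := hε₂ <;> simp, ?_⟩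
  -- On the class of `g` the two vectors contribute `ε₁ * X` and `ε₁ * Y`, which cancel because `Y =
  -- -X` there.
  convert! AddSubgroup.add_mem _ hv₁ (AddSubgroup.zsmul_mem _ hv₂ ε₁) using 1
  ext h
  simp only [Pi.add_apply, Pi.smul_apply, smul_eq_mul]
  obtain ⟨-, h1, h2, h3⟩ | ⟨h1, h2, h3⟩ | ⟨h1, h2, h3⟩ | ⟨h1, h2, h3⟩ | ⟨h1, h2, h3⟩ := cases h
  · simp [h1, h2, h3]
  · simp [h1, h2, h3]
  · simp [h1, h2, h3, mul_assoc]
  · have : Y h ≠ 0 := by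
      rw [h2]; revert h1; generalize X h = s; revert s; decide
    have hcast : ((-X h : SignType) : ℤ) = -(X h : ℤ) := by simp
    simp only [h1, this, h3, if_true, if_false]
    rw [h2, hcast]
    ring
  · simp [h1, h2, h3]

end Matroid

namespace Matroid

variable {α : Type*} {M N : Matroid α}

/-! ### Clones -/

lemma IsCircuit.image_swap [DecidableEq α] {e f : α} {C : Set α} (hC : N.IsCircuit C)
    (h : N.mapEquiv (Equiv.swap e f) = N) : N.IsCircuit (Equiv.swap e f '' C) := by
  have hinv : ∀ S : Set α, Equiv.swap e f '' (Equiv.swap e f '' S) = S := fun S => by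
    rw [← Set.image_comp]
    convert! Set.image_id S
    ext x
    simp
  have hdep : ∀ S, N.Dep S ↔ N.Dep (Equiv.swap e f '' S) := fun S => by
    conv_lhs => rw [← h]
    rw [mapEquiv_dep_iff, Equiv.symm_swap]
  rw [isCircuit_iff] at hC ⊢
  refine ⟨(hdep C).1 hC.1, fun D hD hDC => ?_⟩
  rw [← hC.2 ((hdep D).1 hD) (by rw [← hinv C]; exact Set.image_mono hDC), hinv]

lemma AreClones.dual {e f : α} (h : N.AreClones e f) : N✶.AreClones e f := by
  obtain ⟨he, hf, hef, h⟩ := h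
  refine ⟨he, hf, hef, ?_⟩
  conv_rhs => rw [← h]
  simp only [mapEquiv_eq_map, map_dual]

lemma AreClones.isCocircuit_insert {e f : α} (h : N.AreClones e f) {D : Set α}
    (hD : N.IsCocircuit D) (he : e ∈ D) (hf : f ∉ D) : N.IsCocircuit (insert f (D \ {e})) := by
  classical
  obtain ⟨-, -, hef, h'⟩ := h.dual
  suffices hSD : insert f (D \ {e}) = Equiv.swap e f '' D by
    rw [hSD]
    exact IsCircuit.image_swap hD h'
  ext x
  rw [Set.mem_image]
  constructor
  · rintro (rfl | ⟨hx, hxe⟩)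
    · exact ⟨e, he, Equiv.swap_apply_left _ _⟩
    · exact ⟨x, hx, Equiv.swap_apply_of_ne_of_ne hxe (by rintro rfl; exact hf hx)⟩
  · rintro ⟨y, hy, rfl⟩
    by_cases hye : y = e
    · subst hye; left; exact Equiv.swap_apply_left _ _
    · rw [Equiv.swap_apply_of_ne_of_ne hye (by rintro rfl; exact hf hy)]
      exact Or.inr ⟨hy, hye⟩

/-! ### Lines -/

section Line

variable {R : Matroid α} {e f : α}

/-- In this section `R` is loopless of rank two, and `R.closure {g}` serves as the label of the
parallel class of `g`. -/
lemma isBase_pair_of_closure_ne (hb : R.IsBase {e, f}) (hef : e ≠ f)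
    (hl : ∀ g ∈ R.E, R.IsNonloop g) {a b : α} (ha : a ∈ R.E) (hbE : b ∈ R.E)
    (hab : R.closure {a} ≠ R.closure {b}) : R.IsBase {a, b} := by
  have hne : a ≠ b := by rintro rfl; exact hab rfl
  have hI : R.Indep {a, b} := by
    by_contra h
    exact hab (((hl a ha).closure_eq_closure_iff_eq_or_dep (hl b hbE)).2 (Or.inr h))
  obtain ⟨B, hB, hsub⟩ := hI.exists_isBase_superset
  have hcard : B.encard = ({e, f} : Set α).encard := hB.encard_eq_encard_of_isBase hb
  have hfin : B.Finite := by
    rw [← Set.encard_lt_top_iff, hcard, Set.encard_lt_top_iff]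
    exact Set.toFinite _
  rw [Set.encard_pair hef, ← Set.encard_pair hne] at hcard
  rwa [hfin.eq_of_subset_of_encard_le' hsub hcard.le]

/-- The hyperplanes of a loopless rank-two matroid are its parallel classes. -/
lemma isCocircuit_of_isBase_pair (hb : R.IsBase {e, f}) (hef : e ≠ f)
    (hl : ∀ g ∈ R.E, R.IsNonloop g) {g : α} (hg : g ∈ R.E) :
    R.IsCocircuit {h ∈ R.E | R.closure {h} ≠ R.closure {g}} := by
  have heE := hb.subset_ground (show e ∈ {e, f} by simp)
  have hfE := hb.subset_ground (show f ∈ {e, f} by simp)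
  obtain ⟨h, hh, hne⟩ : ∃ h ∈ R.E, R.closure {h} ≠ R.closure {g} := by
    by_contra! hcon
    have := (hcon e heE).trans (hcon f hfE).symm
    rw [(hl e heE).closure_eq_closure_iff_eq_or_dep (hl f hfE)] at this
    exact this.elim hef fun h => h hb.indep
  have hhg : h ≠ g := by rintro rfl; exact hne rfl
  have := (isBase_pair_of_closure_ne hb hef hl hh hg hne).compl_closure_sdiff_singleton_isCocircuit
    (e := h) (by simp)
  rw [Set.pair_sdiff_left hhg] at this
  convert! this using 1
  ext x
  constructor
  · rintro ⟨hx, hxg⟩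
    exact ⟨hx, fun hcl => hxg ((hl x hx).closure_eq_of_mem_closure hcl)⟩
  · rintro ⟨hx, hxg⟩
    exact ⟨hx, fun hcl => hxg (hcl ▸ R.mem_closure_self x hx)⟩

lemma isCircuit_triple_of_isBase_pair (hb : R.IsBase {e, f}) (hef : e ≠ f)
    (hl : ∀ g ∈ R.E, R.IsNonloop g) {a b c : α} (ha : a ∈ R.E) (hbE : b ∈ R.E) (hc : c ∈ R.E)
    (hab : R.closure {a} ≠ R.closure {b}) (hac : R.closure {a} ≠ R.closure {c})
    (hbc : R.closure {b} ≠ R.closure {c}) : R.IsCircuit {a, b, c} := by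
  have hB := isBase_pair_of_closure_ne hb hef hl hbE hc hbc
  have hne : b ≠ c := by rintro rfl; exact hbc rfl
  refine hB.indep.insert_isCircuit_of_forall ?_ (by rwa [hB.closure_eq]) ?_
  · rintro (rfl | rfl)
    · exact hab rfl
    · exact hac rfl
  · rintro g (rfl | rfl) hcl
    · rw [Set.pair_sdiff_left hne] at hcl
      exact hac ((hl a ha).closure_eq_of_mem_closure hcl)
    · rw [Set.pair_sdiff_right hne] at hcl
      exact hab ((hl a ha).closure_eq_of_mem_closure hcl)

/-- If two cocircuits cover the ground set and miss exactly one element each, then these two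
elements form a base. -/
lemma isBase_pair_of_isCocircuit (hef : e ≠ f) (he : e ∈ R.E) (hf : f ∈ R.E)
    (hDe : R.IsCocircuit (R.E \ {e})) (hDf : R.IsCocircuit (R.E \ {f})) : R.IsBase {e, f} := by
  have hen : R.IsNonloop e := hDf.isNonloop_of_mem ⟨he, hef⟩
  have hfn : R.IsNonloop f := hDe.isNonloop_of_mem ⟨hf, hef.symm⟩
  rw [isCocircuit_iff_minimal_compl_nonspanning, Set.minimal_iff_forall_ssubset] at hDf
  obtain ⟨hns, hsp⟩ := hDf
  have hss : R.E \ {e, f} ⊂ R.E \ {f} :=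
    ⟨fun x hx => ⟨hx.1, fun h => hx.2 (Or.inr h)⟩, fun h => (h ⟨he, hef⟩).2 (by simp)⟩
  have hsub : ({e, f} : Set α) ⊆ R.E := by rintro x (rfl | rfl) <;> assumption
  have hsp' := hsp hss
  rw [not_not, Set.sdiff_sdiff_cancel_left hsub] at hsp'
  rw [Set.sdiff_sdiff_cancel_left (by simpa using hf)] at hns
  refine Indep.isBase_of_spanning ?_ hsp'
  by_contra hI
  -- Were `e` and `f` parallel, `f` alone would span, although {f} is the complement of a cocircuit.
  have hcl := (hen.closure_eq_closure_iff_eq_or_dep hfn).2 (Or.inr hI)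
  apply hns
  rw [spanning_iff_closure_eq, ← hsp'.closure_eq, closure_insert_eq_of_mem_closure]
  rw [← hcl]
  exact R.mem_closure_self e

end Line

/-! ### Small vectors from clones -/

/-- In a simple matroid with a pair of clones and a dual pair of signings, the lattice generated
by the signed cocircuits contains a small vector. -/
lemma AreClones.exists_isSmallVector [N.Finite] (hs : N.IsSimple) {e f : α}
    (hcl : N.AreClones e f) {𝒞 𝒟 : Set (α → SignType)}
    (h𝒞 : ∀ C, N.IsCircuit C → ∃ X ∈ 𝒞, Function.support X = C)
    (h𝒟 : ∀ K, N.IsCocircuit K → ∃ Y ∈ 𝒟, Function.support Y = K)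
    (horth : ∀ X ∈ 𝒞, ∀ Y ∈ 𝒟, SignOrthogonal X Y) (hneg : ∀ Y ∈ 𝒟, -Y ∈ 𝒟) :
    ∃ x ∈ AddSubgroup.closure ((fun (X : α → SignType) e => (X e : ℤ)) '' 𝒟),
      IsSmallVector x := by
  have heE := hcl.1
  have hfE := hcl.2.1
  have hef := hcl.2.2.1
  have hI : N.Indep {e, f} := by
    by_contra h
    have hd : N.Dep {e, f} := ⟨h, by rintro x (rfl | rfl) <;> assumption⟩
    obtain ⟨C, hC, hCc⟩ := hd.exists_isCircuit_subset
    have := (hs C hCc).trans_le (Set.encard_le_encard hC)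
    rw [Set.encard_pair hef] at this
    exact lt_irrefl _ this
  obtain ⟨D, hD, hDe⟩ := hI.exists_isCocircuit_inter_eq_mem (e := e) (by simp)
  have heD : e ∈ D := (hDe.symm.subset rfl).1
  have hfD : f ∉ D := fun h => hef (hDe.subset ⟨h, by simp⟩ : f = e).symm
  have hD' := hcl.isCocircuit_insert hD heD hfD
  -- Contracting `L` keeps both `D` and its clone image as cocircuits; each misses just one element
  -- of what remains.
  set L := N.E \ insert f D with hL
  have hRE : (N ／ L).E = insert f D := by
    rw [contract_ground, hL, Set.sdiff_sdiff_cancel_left]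
    exact Set.insert_subset hfE hD.subset_ground
  set R := N ／ L with hR
  have hRDf : R.IsCocircuit (R.E \ {f}) := by
    rw [hRE, Set.insert_sdiff_self_of_notMem hfD, hR, contract_isCocircuit_iff]
    exact ⟨hD, Set.disjoint_left.2 fun x hx hxL => hxL.2 (Or.inr hx)⟩
  have hRDe : R.IsCocircuit (R.E \ {e}) := by
    rw [hRE, ← Set.insert_sdiff_singleton_comm hef.symm, hR, contract_isCocircuit_iff]
    refine ⟨hD', Set.disjoint_left.2 fun x hx hxL => hxL.2 ?_⟩
    exact hx.imp id fun h => h.1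
  have heR : e ∈ R.E := by rw [hRE]; exact Or.inr heD
  have hfR : f ∈ R.E := by rw [hRE]; exact Or.inl rfl
  have hb := isBase_pair_of_isCocircuit hef heR hfR hRDe hRDf
  have hl : ∀ g ∈ R.E, R.IsNonloop g := fun g hg => by
    by_cases hge : g = e
    · exact hRDf.isNonloop_of_mem ⟨hg, by rw [hge]; exact hef⟩
    · exact hRDe.isNonloop_of_mem ⟨hg, hge⟩
  have hcoc : ∀ g ∈ R.E, R.IsCocircuit {h ∈ R.E | R.closure {h} ≠ R.closure {g}} :=
    fun g hg => isCocircuit_of_isBase_pair hb hef hl hg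
  -- One cocircuit inside another equals it, so `g` is alone in its parallel class.
  have hsingle : ∀ g ∈ R.E, R.IsCocircuit (R.E \ {g}) →
      {h ∈ R.E | R.closure {h} ≠ R.closure {g}} = R.E \ {g} := fun g hg hK =>
    (hcoc g hg).eq_of_subset_isCircuit hK fun x hx => ⟨hx.1, by rintro rfl; exact hx.2 rfl⟩
  -- The traces in `𝒞'` need not all be circuits of `R`; they only have to include every circuit and
  -- stay orthogonal to `𝒟'`. Since `𝒟'` is part of `𝒟`, the lattice vector found in `R` belongs to
  -- the original lattice.
  set 𝒞' : Set (α → SignType) := (fun X => Set.indicator Lᶜ X) '' 𝒞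
  set 𝒟' : Set (α → SignType) := {Y ∈ 𝒟 | ∀ g ∈ L, Y g = 0}
  have hC' : ∀ C, R.IsCircuit C → ∃ X ∈ 𝒞', Function.support X = C := by
    intro C hC
    obtain ⟨C', hC', hCC', hC'L⟩ := hC.exists_subset_isCircuit_of_contract
    obtain ⟨X, hX, rfl⟩ := h𝒞 C' hC'
    refine ⟨_, ⟨X, hX, rfl⟩, ?_⟩
    rw [Set.support_indicator]
    ext x
    exact ⟨fun hx => (hC'L hx.2).resolve_right hx.1,
      fun hx => ⟨(hC.subset_ground hx).2, hCC' hx⟩⟩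
  have hD'' : ∀ K, R.IsCocircuit K → ∃ Y ∈ 𝒟', Function.support Y = K := by
    intro K hK
    rw [hR, contract_isCocircuit_iff] at hK
    obtain ⟨Y, hY, rfl⟩ := h𝒟 K hK.1
    exact ⟨Y, ⟨hY, fun g hg => by
      by_contra h
      exact Set.disjoint_left.1 hK.2 h hg⟩, rfl⟩
  have horth' : ∀ X ∈ 𝒞', ∀ Y ∈ 𝒟', SignOrthogonal X Y := by
    rintro _ ⟨X, hX, rfl⟩ Y ⟨hY, hYL⟩
    refine (horth X hX Y hY).congr fun x => ?_
    by_cases hx : x ∈ L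
    · simp [hYL x hx]
    · simp [hx]
  have hneg' : ∀ Y ∈ 𝒟', -Y ∈ 𝒟' := fun Y hY =>
    ⟨hneg Y hY.1, fun g hg => by rw [Pi.neg_apply, hY.2 g hg]; rfl⟩
  obtain ⟨X, hX, hXs⟩ := hD'' _ (hcoc f hfR)
  obtain ⟨Y, hY, hYs⟩ := hD'' _ (hcoc e heR)
  have hfe : R.closure {f} ≠ R.closure {e} := fun h => by
    have : e ∈ R.E \ {f} := ⟨heR, hef⟩
    rw [← hsingle f hfR hRDf] at this
    exact this.2 h.symm
  obtain ⟨ε, hε, hv⟩ := exists_sign_mem_closure_of_line (R.ground_finite)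
    (fun g => R.closure {g}) horth' hneg'
    (fun a ha b _ hab h => hC' _ (((hl a ha).closure_eq_closure_iff_isCircuit_of_ne hab).1 h))
    (fun a ha b hb' c hc h1 h2 h3 =>
      hC' _ (isCircuit_triple_of_isBase_pair hb hef hl ha hb' hc h1 h2 h3))
    (fun g hg => hD'' _ (hcoc g hg)) hfR heR hfe hX hXs hY hYs
  rw [hsingle f hfR hRDf] at hXs
  rw [hsingle e heR hRDe] at hYs
  refine ⟨_, AddSubgroup.closure_mono (Set.image_mono fun Y hY => hY.1) hv, ?_, ?_, ?_⟩
  · intro h0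
    have h1 := congrFun h0 f
    have hXf : f ∉ Function.support X := by rw [hXs]; simp
    have hYf : Y f ≠ 0 := by
      have : f ∈ Function.support Y := by rw [hYs]; exact ⟨hfR, hef.symm⟩
      exact this
    rw [Function.notMem_support] at hXf
    simp only [hXf, if_true, Pi.zero_apply] at h1
    revert h1 hYf
    generalize Y f = s
    revert s
    decide
  · intro g
    have aux : ∀ s : SignType, (s : ℤ) = 0 ∨ (s : ℤ) = 1 ∨ (s : ℤ) = -1 := by decide
    have aux' : ∀ s : SignType, -1 * (s : ℤ) = 0 ∨ -1 * (s : ℤ) = 1 ∨ -1 * (s : ℤ) = -1 := by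
      decide
    dsimp only
    split_ifs
    · exact aux _
    · obtain rfl | rfl := hε
      · rw [one_mul]; exact aux _
      · exact aux' _
    · exact Or.inl rfl
  · rw [← Set.encard_pair hef]
    apply Set.encard_le_encard
    intro g hg
    by_contra hgef
    simp only [Set.mem_insert_iff, Set.mem_singleton_iff, not_or] at hgef
    apply hg
    -- Away from `e` and `f` the two cocircuits have the same zeros, and the combined vector
    -- vanishes whether both are zero or both are nonzero.
    have hXY : g ∈ Function.support X ↔ g ∈ Function.support Y := by
      rw [hXs, hYs]; simp [hgef.1, hgef.2]
    rw [Function.mem_support, Function.mem_support, not_iff_not] at hXY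
    by_cases h : X g = 0
    · simp [h, hXY.1 h]
    · simp [h, mt hXY.2 h]

/-- Simplicity rules out a loop, so the element is a coloop and forms a cocircuit by itself. -/
lemma exists_isSmallVector_of_ground_eq_singleton (hs : N.IsSimple) {e : α} (hE : N.E = {e})
    {𝒟 : Set (α → SignType)} (h𝒟 : ∀ K, N.IsCocircuit K → ∃ Y ∈ 𝒟, Function.support Y = K) :
    ∃ x ∈ AddSubgroup.closure ((fun (X : α → SignType) e => (X e : ℤ)) '' 𝒟),
      IsSmallVector x := by
  have hcol : N.IsColoop e := by
    rw [isColoop_iff_forall_notMem_isCircuit (by rw [hE]; rfl)]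
    intro C hC _
    have := (hs C hC).trans_le (Set.encard_le_encard (hE ▸ hC.subset_ground))
    rw [Set.encard_singleton] at this
    exact absurd this (by decide)
  obtain ⟨Y, hY, hYs⟩ := h𝒟 _ hcol.isCocircuit
  have nz : ∀ s : SignType, (s : ℤ) = 0 ↔ s = 0 := by decide
  have hsupp : Function.support (fun g => (Y g : ℤ)) = {e} := by
    rw [← hYs]
    ext g
    simp only [Function.mem_support, ne_eq, nz]
  refine ⟨_, AddSubgroup.subset_closure ⟨Y, hY, rfl⟩, ?_, fun g => ?_, ?_⟩
  · intro h
    dsimp only at h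
    rw [h, Function.support_zero] at hsupp
    exact Set.singleton_ne_empty _ hsupp.symm
  · have aux : ∀ s : SignType, (s : ℤ) = 0 ∨ (s : ℤ) = 1 ∨ (s : ℤ) = -1 := by decide
    exact aux _
  · dsimp only
    rw [hsupp, Set.encard_singleton]
    exact one_le_two

/-- A dual pair of signings of a simple nonempty matroid, which has clones if it has two elements,
has a small vector in the lattice generated by the signed cocircuits. -/
lemma IsSimple.exists_isSmallVector [N.Finite] (hs : N.IsSimple) (hne : N.E.Nonempty)
    (hcl : 2 ≤ N.E.encard → ∃ e f, N.AreClones e f) {𝒞 𝒟 : Set (α → SignType)}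
    (h𝒞 : ∀ C, N.IsCircuit C → ∃ X ∈ 𝒞, Function.support X = C)
    (h𝒟 : ∀ K, N.IsCocircuit K → ∃ Y ∈ 𝒟, Function.support Y = K)
    (horth : ∀ X ∈ 𝒞, ∀ Y ∈ 𝒟, SignOrthogonal X Y) (hneg : ∀ Y ∈ 𝒟, -Y ∈ 𝒟) :
    ∃ x ∈ AddSubgroup.closure ((fun (X : α → SignType) e => (X e : ℤ)) '' 𝒟),
      IsSmallVector x := by
  by_cases h2 : 2 ≤ N.E.encard
  · obtain ⟨e, f, h⟩ := hcl h2
    exact h.exists_isSmallVector hs h𝒞 h𝒟 horth hneg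
  · obtain ⟨e, he⟩ := hne
    refine exists_isSmallVector_of_ground_eq_singleton hs (e := e) ?_ h𝒟
    refine Set.Subset.antisymm (fun x hx => ?_) (by simpa using he)
    by_contra hxe
    apply h2
    rw [← Set.encard_pair (show x ≠ e from hxe)]
    exact Set.encard_le_encard (by rintro y (rfl | rfl) <;> assumption)

end Matroid

theorem mainTheorem7 {α : Type*} (M : Matroid α) [M.Finite] (hM : M.CloneReducible)
    (O : M.Orientation) : O.IsGSP ∧ O.IsCoGSP := by
  constructor
  · intro A B hne hs
    exact hs.exists_isSmallVector hne (fun h2 => hM _ ⟨A, B, rfl⟩ h2)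
      (fun C hC => ((O.toSignedCircuits.minor A B).isCircuit_iff C).1 hC)
      (fun K hK => O.exists_mem_cocircuits_minor A B hK)
      (fun X hX Y hY => hY.2 X hX)
      (fun Y hY => ⟨by rw [Matroid.support_neg_sign]; exact hY.1,
        fun X hX => (hY.2 X hX).neg_right⟩)
  · intro A B hne hs
    -- In the dual minor, signed cocircuits play the part of `𝒞` and signed circuits that of `𝒟`.
    refine Matroid.IsSimple.exists_isSmallVector (N := ((M.contract A).delete B)✶) hs hne
      (fun h2 => ?_)
      (fun K hK => O.exists_mem_cocircuits_minor A B hK)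
      (fun C hC => ((O.toSignedCircuits.minor A B).isCircuit_iff C).1
        (Matroid.dual_isCocircuit_iff.1 hC))
      (fun X hX Y hY => (hX.2 Y hY).symm)
      (O.toSignedCircuits.minor A B).neg_mem
    obtain ⟨e, f, h⟩ := hM _ ⟨A, B, rfl⟩ h2
    exact ⟨e, f, h.dual⟩
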